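/- **Theorem 2.6.** Let $n\ge 1$ be an integer, $p,q\in[1,\infty)$ and $\lambda,\sigma,\alpha,\beta\in(0,\infty)$. *Notation.* For $\alpha>0$ let $$\Phi_\alpha(x,t)=\frac{t^{\alpha-1}}{\Gamma(\alpha)}\,\frac{1}{(4\pi t)^{n/2}}\,e^{-|x|^2/(4t)}\ \text{ for } t>0,\qquad \Phi_\alpha(x,t)=0\ \text{ for } t\le 0,$$ $$J_\alpha f(x,t)=\iint_{\mathbb R^n\times(-\infty,t)}\Phi_\alpha(x-\xi,t-\tau)f(\xi,\tau)\,d\xi\,d\tau ,$$ let $X^p$ be the set of measurable $f:\mathbb R^n\times\mathbb R\to\mathbb R$ with $\|f\|_{L^p(\mathbb R^n\times(-\infty,T))}<\infty$ for all $T\in\mathbb R$, and let $Y^p_\alpha=J_\alpha(X^p)$. When $$\Big(p>1\text{ and }0<\alpha<\tfrac{n+2}{2p}\Big)\quad\text{or}\quad\Big(p=1\text{ and }0<\alpha\le\tfrac{n+2}{2p}\Big),\tag{1}$$ the fractional heat operator $(\partial_t-\Delta)^\alpha:Y^p_\alpha\to X^p$ is the inverse of $J_\alpha:X^p\to Y^p_\alpha$;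 that is, $(\partial_t-\Delta)^\alpha u=f$ means that $f\in X^p$ and $u=J_\alpha f$. Functions are identified when they agree almost everywhere, and relations between them are understood almost everywhere. *Assumptions.* Suppose that (1) holds, that (1) also holds with $(q,\beta)$ in place of $(p,\alpha)$, that $$(n+2-2p\alpha)\,q^2\sigma\le(n+2-2q\beta)\,p^2\lambda ,\qquad 2p\alpha<n+2,$$ and that $$\sigma>\mu(\lambda):=\frac{2p\beta}{n+2-2p\alpha}+\frac{n+2}{(n+2-2p\alpha)\lambda}.$$ *Conclusion.* Let $$r_0=\frac{(n+2)(\lambda\sigma-1)}{2(\beta+\alpha\sigma)\lambda}\qquad\text{and}\qquad s_0=\frac{(n+2)(\lambda\sigma-1)}{2(\alpha+\beta\lambda)\sigma}.$$ Then $r_0>p$ and $s_0>q$, and for each $r\in[r_0,\infty]$ and $s\in[s_0,\infty]$ there exist nonnegative solutions $u\in Y^p_\alpha$ and $v\in Y^q_\beta$ of $$0\le(\partial_t-\Delta)^\alpha u\le v^\lambda,\qquad 0\le(\partial_t-\Delta)^\beta v\le u^\sigma\qquad\text{in }\mathbb R^n\times\mathbb R,$$ $$u=v=0\qquad\text{in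 }\mathbb R^n\times(-\infty,0),$$ and a sequence $\{t_j\}_{j\ge1}\subset(1,\infty)$ with $\lim_{j\to\infty}t_j=\infty$ such that, for every $j$, $$\|v^\lambda\|_{L^r(R_j)}=\|(\partial_t-\Delta)^\alpha u\|_{L^r(R_j)}=\infty,\qquad \|u^\sigma\|_{L^s(R_j)}=\|(\partial_t-\Delta)^\beta v\|_{L^s(R_j)}=\infty,$$ where $R_j=\{(x,t)\in\mathbb R^n\times\mathbb R:|x|<\sqrt{t_j}\text{ and }t_j<t<2t_j\}$. -/

import Mathlib

open MeasureTheory Filter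
open scoped ENNReal

noncomputable section

/-- Space-time `ℝⁿ × ℝ`, with the Euclidean norm on `ℝⁿ`; a point is `z = (x, t)`. -/
abbrev SpaceTime (n : ℕ) : Type := EuclideanSpace ℝ (Fin n) × ℝ

/-- The half space `ℝⁿ × (-∞, T)`. -/
def pastOf (n : ℕ) (T : ℝ) : Set (SpaceTime n) := {w | w.2 < T}

/-- The fractional heat kernel
`Φ_α(x,t) = t^(α-1) / Γ(α) * (4πt)^(-n/2) * exp(-|x|²/(4t))` for `t > 0`, and `0` for `t ≤ 0`. -/
def fracHeatKernel (n : ℕ) (α : ℝ) (z : SpaceTime n) : ℝ :=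
  if 0 < z.2 then
    z.2 ^ (α - 1) / Real.Gamma α * (1 / (4 * Real.pi * z.2) ^ ((n : ℝ) / 2)) *
      Real.exp (-‖z.1‖ ^ 2 / (4 * z.2))
  else 0

/-- The integrand `(ξ,τ) ↦ Φ_α(x-ξ, t-τ) f(ξ,τ)` of `J_α f (x,t)`. -/
def potentialIntegrand {n : ℕ} (α : ℝ) (f : SpaceTime n → ℝ) (z w : SpaceTime n) : ℝ :=
  fracHeatKernel n α (z - w) * f w

/-- `J_α f (x,t) = ∬_{ℝⁿ × (-∞,t)} Φ_α(x-ξ, t-τ) f(ξ,τ) dξ dτ`. -/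
def fracHeatPotential {n : ℕ} (α : ℝ) (f : SpaceTime n → ℝ) (z : SpaceTime n) : ℝ :=
  ∫ w in pastOf n z.2, potentialIntegrand α f z w

/-- `f ∈ X^p`: `f` is measurable and lies in `L^p(ℝⁿ × (-∞,T))` for every real `T`. -/
def MemX {n : ℕ} (p : ℝ) (f : SpaceTime n → ℝ) : Prop :=
  ∀ T : ℝ, MemLp f (ENNReal.ofReal p) (volume.restrict (pastOf n T))

/-- The graph of `(∂ₜ - Δ)^α : Y^p_α → X^p`, the inverse of `J_α : X^p → Y^p_α = J_α(X^p)`.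
`HasFracHeat p α u f` says that `u ∈ Y^p_α` and `(∂ₜ - Δ)^α u = f`, that is, `f ∈ X^p` and
`u = J_α f`. As usual functions are identified when they agree almost everywhere; the integral
defining `J_α f` is required to converge absolutely almost everywhere, so that the equation
never refers to the default value of a divergent integral. -/
structure HasFracHeat {n : ℕ} (p α : ℝ) (u f : SpaceTime n → ℝ) : Prop where
  memX : MemX p f
  convergent : ∀ᵐ z : SpaceTime n, IntegrableOn (potentialIntegrand α f z) (pastOf n z.2)
  eq_potential : ∀ᵐ z : SpaceTime n, u z = fracHeatPotential α f z

/-- The range of exponents in which `(∂ₜ - Δ)^α : Y^p_α → X^p` is defined. -/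
def AdmissibleExponents (n : ℕ) (p α : ℝ) : Prop :=
  (1 < p ∧ 0 < α ∧ α < ((n : ℝ) + 2) / (2 * p)) ∨
    (p = 1 ∧ 0 < α ∧ α ≤ ((n : ℝ) + 2) / (2 * p))

/-- `u ∈ Y^p_α` and `v ∈ Y^q_β` are nonnegative, with `f = (∂ₜ - Δ)^α u` and
`g = (∂ₜ - Δ)^β v`, and solve
`0 ≤ (∂ₜ - Δ)^α u ≤ v^lam`, `0 ≤ (∂ₜ - Δ)^β v ≤ u^σ` in `ℝⁿ × ℝ`,
`u = v = 0` in `ℝⁿ × (-∞, 0)`. -/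
structure IsSolutionPair {n : ℕ} (p q lam σ α β : ℝ) (u v f g : SpaceTime n → ℝ) : Prop where
  fracHeat_u : HasFracHeat p α u f
  fracHeat_v : HasFracHeat q β v g
  nonneg_u : ∀ᵐ z : SpaceTime n, 0 ≤ u z
  nonneg_v : ∀ᵐ z : SpaceTime n, 0 ≤ v z
  ineq_u : ∀ᵐ z : SpaceTime n, 0 ≤ f z ∧ f z ≤ v z ^ lam
  ineq_v : ∀ᵐ z : SpaceTime n, 0 ≤ g z ∧ g z ≤ u z ^ σ
  initial : ∀ᵐ z : SpaceTime n, z.2 < 0 → u z = 0 ∧ v z = 0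

/-- The curve `μ(lam) = 2pβ/(n+2-2pα) + (n+2)/((n+2-2pα) lam)`. -/
def muCurve (n : ℕ) (p α β lam : ℝ) : ℝ :=
  2 * p * β / ((n : ℝ) + 2 - 2 * p * α) + ((n : ℝ) + 2) / (((n : ℝ) + 2 - 2 * p * α) * lam)

/-- `r₀ = (n+2)(lam σ - 1) / (2 (β + α σ) lam)`. -/
def rZero (n : ℕ) (lam σ α β : ℝ) : ℝ :=
  ((n : ℝ) + 2) * (lam * σ - 1) / (2 * (β + α * σ) * lam)

/-- `s₀ = (n+2)(lam σ - 1) / (2 (α + β lam) σ)`. -/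
def sZero (n : ℕ) (lam σ α β : ℝ) : ℝ :=
  ((n : ℝ) + 2) * (lam * σ - 1) / (2 * (α + β * lam) * σ)

/-- The region `{(x,t) : |x| < √a and a < t < 2a}`. -/
def parabolicRegion (n : ℕ) (a : ℝ) : Set (SpaceTime n) :=
  {z | ‖z.1‖ < √a ∧ a < z.2 ∧ z.2 < 2 * a}

end

instance spaceTime_isAddHaarMeasure (n : ℕ) :
    (volume : Measure (SpaceTime n)).IsAddHaarMeasure :=
  inferInstanceAs
    ((volume : Measure (EuclideanSpace ℝ (Fin n))).prod (volume : Measure ℝ)).IsAddHaarMeasure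

theorem measurableSet_pastOf (n : ℕ) (T : ℝ) : MeasurableSet (pastOf n T) :=
  measurableSet_lt measurable_snd measurable_const

/-- The time slab `ℝⁿ × (m, m + 1)`. -/
def timeSlab (n m : ℕ) : Set (SpaceTime n) := Set.univ ×ˢ Set.Ioo (m : ℝ) (m + 1)

theorem measurableSet_timeSlab (n m : ℕ) : MeasurableSet (timeSlab n m) :=
  MeasurableSet.univ.prod measurableSet_Ioo

/-- The union of the unit forward paraboloids `|x|² < t - m < 1` with vertices `(0, m)`,
`m = 2, 3, …`. -/
def paraboloids (n : ℕ) : Set (SpaceTime n) := {z | 2 ≤ z.2 ∧ ‖z.1‖ ^ 2 < Int.fract z.2}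

/-- The function `(t - m)^(-κ)` on the `m`-th unit forward paraboloid, extended by `0`. -/
noncomputable def paraboloidPower (n : ℕ) (κ : ℝ) (z : SpaceTime n) : ℝ :=
  (paraboloids n).indicator (fun z => Int.fract z.2 ^ (-κ)) z

theorem measurableSet_paraboloids (n : ℕ) : MeasurableSet (paraboloids n) :=
  (measurableSet_le measurable_const measurable_snd).inter
    (measurableSet_lt (by fun_prop) (measurable_fract.comp measurable_snd))

theorem fract_pos_of_mem_paraboloids {n : ℕ} {z : SpaceTime n} (hz : z ∈ paraboloids n) :
    0 < Int.fract z.2 := (sq_nonneg _).trans_lt hz.2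

theorem mem_timeSlab_of_mem_paraboloids {n : ℕ} {z : SpaceTime n} (hz : z ∈ paraboloids n) :
    z ∈ timeSlab n ⌊z.2⌋₊ := by
  have h0 : 0 ≤ z.2 := zero_le_two.trans hz.1
  have h1 := fract_pos_of_mem_paraboloids hz
  have h2 : z.2 - ⌊z.2⌋₊ = Int.fract z.2 := by
    rw [Int.fract, natCast_floor_eq_intCast_floor h0]
  exact ⟨trivial, by linarith, Nat.lt_floor_add_one _⟩

theorem measurable_paraboloidPower (n : ℕ) (κ : ℝ) : Measurable (paraboloidPower n κ) :=
  ((measurable_fract.comp measurable_snd).pow_const _).indicator (measurableSet_paraboloids n)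

theorem paraboloidPower_nonneg (n : ℕ) (κ : ℝ) (z : SpaceTime n) : 0 ≤ paraboloidPower n κ z :=
  Set.indicator_nonneg (fun _ _ => Real.rpow_nonneg (Int.fract_nonneg _) _) _

theorem paraboloidPower_of_mem {n : ℕ} {z : SpaceTime n} (κ : ℝ) (hz : z ∈ paraboloids n) :
    paraboloidPower n κ z = Int.fract z.2 ^ (-κ) := Set.indicator_of_mem hz _

theorem paraboloidPower_of_notMem {n : ℕ} {z : SpaceTime n} (κ : ℝ) (hz : z ∉ paraboloids n) :
    paraboloidPower n κ z = 0 := Set.indicator_of_notMem hz _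

theorem paraboloidPower_rpow {n : ℕ} {p : ℝ} (hp : 0 < p) (κ : ℝ) (z : SpaceTime n) :
    paraboloidPower n κ z ^ p = paraboloidPower n (κ * p) z := by
  by_cases hz : z ∈ paraboloids n
  · rw [paraboloidPower_of_mem _ hz, paraboloidPower_of_mem _ hz,
      ← Real.rpow_mul (Int.fract_nonneg _), neg_mul]
  · rw [paraboloidPower_of_notMem _ hz, paraboloidPower_of_notMem _ hz, Real.zero_rpow hp.ne']

theorem volumeReal_ball_euclidean (n : ℕ) {ρ : ℝ} (hρ : 0 < ρ) :
    volume.real (Metric.ball (0 : EuclideanSpace ℝ (Fin n)) ρ) =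
      ρ ^ n * volume.real (Metric.ball (0 : EuclideanSpace ℝ (Fin n)) 1) := by
  rw [Measure.real, Measure.addHaar_ball_of_pos _ _ hρ, ENNReal.toReal_mul,
    ENNReal.toReal_ofReal (by positivity), finrank_euclideanSpace, Fintype.card_fin, Measure.real]

theorem volumeReal_unitBall_pos (n : ℕ) :
    0 < volume.real (Metric.ball (0 : EuclideanSpace ℝ (Fin n)) 1) :=
  ENNReal.toReal_pos (Metric.measure_ball_pos _ _ one_pos).ne' measure_ball_lt_top.ne

theorem paraboloidPower_slice {n : ℕ} (κ : ℝ) {s : ℝ} (hs : 2 ≤ s) :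
    (fun x : EuclideanSpace ℝ (Fin n) => paraboloidPower n κ (x, s)) =
      (Metric.ball (0 : EuclideanSpace ℝ (Fin n)) √(Int.fract s)).indicator
        (fun _ => Int.fract s ^ (-κ)) := by
  ext x
  simp only [paraboloidPower, Set.indicator]
  congr 1
  simp [paraboloids, hs, Real.lt_sqrt (norm_nonneg x)]

theorem sqrt_pow_eq_rpow_half {s : ℝ} (hs : 0 ≤ s) (n : ℕ) : √s ^ n = s ^ ((n : ℝ) / 2) := by
  rw [Real.sqrt_eq_rpow, ← Real.rpow_natCast, ← Real.rpow_mul hs]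
  congr 1
  ring

theorem integrableOn_paraboloidPower_timeSlab_iff (n : ℕ) (κ : ℝ) {m : ℕ} (hm : 2 ≤ m) :
    IntegrableOn (paraboloidPower n κ) (timeSlab n m) ↔ κ < (n : ℝ) / 2 + 1 := by
  have hm' : (2 : ℝ) ≤ m := by exact_mod_cast hm
  have hvol : (volume : Measure (SpaceTime n)).restrict (timeSlab n m) =
      (volume : Measure (EuclideanSpace ℝ (Fin n))).prod
        (volume.restrict (Set.Ioo (m : ℝ) (m + 1))) := by
    rw [timeSlab, Measure.volume_eq_prod, ← Measure.prod_restrict, Measure.restrict_univ]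
  have hfr : ∀ s ∈ Set.Ioo (m : ℝ) (m + 1), Int.fract s = s - m := by
    intro s hs
    rw [Int.fract, show ⌊s⌋ = (m : ℤ) from
      Int.floor_eq_iff.2 ⟨by exact_mod_cast hs.1.le, by exact_mod_cast hs.2⟩]
    simp
  set ω := volume.real (Metric.ball (0 : EuclideanSpace ℝ (Fin n)) 1) with hω
  have hωpos : 0 < ω := volumeReal_unitBall_pos n
  have hfib : ∀ s ∈ Set.Ioo (m : ℝ) (m + 1),
      ∫ x : EuclideanSpace ℝ (Fin n), ‖paraboloidPower n κ (x, s)‖ =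
        ω * (s - m) ^ ((n : ℝ) / 2 - κ) := by
    intro s hs
    have hs0 : 0 < s - m := sub_pos.2 hs.1
    simp_rw [Real.norm_of_nonneg (paraboloidPower_nonneg n κ _)]
    rw [paraboloidPower_slice κ (hm'.trans hs.1.le), hfr s hs,
      integral_indicator_const _ measurableSet_ball,
      volumeReal_ball_euclidean n (Real.sqrt_pos.2 hs0), sqrt_pow_eq_rpow_half hs0.le,
      sub_eq_add_neg ((n : ℝ) / 2), Real.rpow_add hs0, smul_eq_mul]
    ring
  rw [IntegrableOn, hvol, integrable_prod_iff'
    (measurable_paraboloidPower n κ).aestronglyMeasurable]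
  have h1 : ∀ᵐ s ∂volume.restrict (Set.Ioo (m : ℝ) (m + 1)),
      Integrable (fun x : EuclideanSpace ℝ (Fin n) => paraboloidPower n κ (x, s)) := by
    refine (ae_restrict_mem measurableSet_Ioo).mono fun s hs => ?_
    rw [paraboloidPower_slice κ (hm'.trans hs.1.le)]
    exact (integrable_indicator_iff measurableSet_ball).2
      (integrableOn_const measure_ball_lt_top.ne)
  rw [and_iff_right h1]
  change IntegrableOn _ _ _ ↔ _
  rw [integrableOn_congr_fun hfib measurableSet_Ioo]
  have h2 := (measurePreserving_sub_right (volume : Measure ℝ) (m : ℝ)).integrableOn_comp_preimage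
    (measurableEmbedding_subRight (m : ℝ)) (s := Set.Ioo 0 1)
    (f := fun s : ℝ => ω * s ^ ((n : ℝ) / 2 - κ))
  rw [Set.preimage_sub_const_Ioo, zero_add, add_comm] at h2
  refine h2.trans ?_
  rw [IntegrableOn, integrable_const_mul_iff hωpos.ne'.isUnit]
  exact (intervalIntegral.integrableOn_Ioo_rpow_iff one_pos).trans
    ⟨fun h => by linarith, fun h => by linarith⟩

theorem integrableOn_paraboloidPower_pastOf (n : ℕ) {κ : ℝ} (hκ : κ < (n : ℝ) / 2 + 1) (T : ℝ) :
    IntegrableOn (paraboloidPower n κ) (pastOf n T) := by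
  have h : IntegrableOn (paraboloidPower n κ)
      (⋃ m ∈ Finset.Ico 2 (⌈T⌉₊ + 2), timeSlab n m) :=
    integrableOn_finset_iUnion.2 fun m hm =>
      (integrableOn_paraboloidPower_timeSlab_iff n κ (Finset.mem_Ico.1 hm).1).2 hκ
  refine h.of_forall_sdiff_eq_zero (measurableSet_pastOf n T) fun z hz => ?_
  refine paraboloidPower_of_notMem κ fun hmem => hz.2 ?_
  refine Set.mem_iUnion₂.2 ⟨⌊z.2⌋₊, Finset.mem_Ico.2 ⟨Nat.le_floor (by simpa using hmem.1), ?_⟩,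
    mem_timeSlab_of_mem_paraboloids hmem⟩
  have : ⌊z.2⌋₊ ≤ ⌈T⌉₊ := (Nat.floor_le_floor (le_of_lt hz.1)).trans (Nat.floor_le_ceil _)
  omega

theorem memX_const_mul_paraboloidPower (n : ℕ) {p κ : ℝ} (hp : 1 ≤ p)
    (hκ : κ * p < (n : ℝ) / 2 + 1) (M : ℝ) : MemX p (fun z => M * paraboloidPower n κ z) := by
  intro T
  have hp0 : 0 < p := zero_lt_one.trans_le hp
  refine MemLp.const_mul ?_ M
  refine (integrable_norm_rpow_iff (measurable_paraboloidPower n κ).aestronglyMeasurable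
    (by simpa using hp0) ENNReal.ofReal_ne_top).1 ?_
  simp_rw [ENNReal.toReal_ofReal hp0.le, Real.norm_of_nonneg (paraboloidPower_nonneg n κ _),
    paraboloidPower_rpow hp0]
  exact integrableOn_paraboloidPower_pastOf n hκ T

theorem parabolicRegion_subset (n : ℕ) (a : ℝ) :
    parabolicRegion n a ⊆ Metric.ball 0 √a ×ˢ Set.Ioo a (2 * a) := fun z hz =>
  ⟨by simpa using hz.1, hz.2⟩

theorem volume_parabolicRegion_ne_top (n : ℕ) (a : ℝ) : volume (parabolicRegion n a) ≠ ∞ := by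
  refine ((measure_mono (parabolicRegion_subset n a)).trans_lt ?_).ne
  rw [Measure.volume_eq_prod, Measure.prod_prod]
  exact ENNReal.mul_lt_top measure_ball_lt_top (by simp)

theorem eLpNorm_paraboloidPower_parabolicRegion_eq_top (n : ℕ) {κ r₀ M : ℝ} {r : ℝ≥0∞}
    (hM : M ≠ 0) (hr₀ : 0 < r₀) (hκ : κ * r₀ = (n : ℝ) / 2 + 1) (hr : ENNReal.ofReal r₀ ≤ r)
    {m : ℕ} (hm : 2 ≤ m) :
    eLpNorm (fun z => M * paraboloidPower n κ z) r
      (volume.restrict (parabolicRegion n m)) = ∞ := by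
  by_contra hne
  have hmeas := measurable_paraboloidPower n κ
  have : IsFiniteMeasure ((volume : Measure (SpaceTime n)).restrict (parabolicRegion n m)) :=
    isFiniteMeasure_restrict.2 (volume_parabolicRegion_ne_top n m)
  have h1 : MemLp (fun z => M * paraboloidPower n κ z) r
      (volume.restrict (parabolicRegion n m)) :=
    ⟨(hmeas.const_mul M).aestronglyMeasurable, lt_top_iff_ne_top.2 hne⟩
  have h2 : MemLp (paraboloidPower n κ) (ENNReal.ofReal r₀)
      (volume.restrict (parabolicRegion n m)) := by
    have := (h1.mono_exponent hr).const_mul M⁻¹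
    simpa [← mul_assoc, inv_mul_cancel₀ hM] using this
  rw [← integrable_norm_rpow_iff hmeas.aestronglyMeasurable (by simpa using hr₀)
    ENNReal.ofReal_ne_top] at h2
  simp_rw [ENNReal.toReal_ofReal hr₀.le, Real.norm_of_nonneg (paraboloidPower_nonneg n κ _),
    paraboloidPower_rpow hr₀] at h2
  have h3 : IntegrableOn (paraboloidPower n (κ * r₀)) (timeSlab n m) := by
    refine IntegrableOn.of_forall_sdiff_eq_zero h2 (measurableSet_timeSlab n m) fun z hz => ?_
    refine paraboloidPower_of_notMem _ fun hmem => hz.2 ⟨?_, hz.1.2.1, ?_⟩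
    · have h4 := hmem.2.trans (Int.fract_lt_one _)
      have h5 : (2 : ℝ) ≤ m := by exact_mod_cast hm
      exact Real.lt_sqrt_of_sq_lt (by linarith)
    · have h5 : (2 : ℝ) ≤ m := by exact_mod_cast hm
      have := hz.1.2.2
      linarith
  exact ((integrableOn_paraboloidPower_timeSlab_iff n _ hm).1 h3).ne hκ

theorem measurable_fracHeatKernel (n : ℕ) (α : ℝ) : Measurable (fracHeatKernel n α) := by
  unfold fracHeatKernel
  refine Measurable.ite (measurableSet_lt measurable_const measurable_snd) ?_ measurable_const
  fun_prop

theorem fracHeatKernel_nonneg (n : ℕ) {α : ℝ} (hα : 0 < α) (z : SpaceTime n) :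
    0 ≤ fracHeatKernel n α z := by
  have := Real.Gamma_pos_of_pos hα
  unfold fracHeatKernel
  split_ifs
  · positivity
  · rfl

theorem integral_exp_neg_sq_div (n : ℕ) {s : ℝ} (hs : 0 < s) :
    ∫ x : EuclideanSpace ℝ (Fin n), Real.exp (-‖x‖ ^ 2 / (4 * s)) =
      (4 * Real.pi * s) ^ ((n : ℝ) / 2) := by
  have h := GaussianFourier.integral_rexp_neg_mul_sq_norm (V := EuclideanSpace ℝ (Fin n))
    (b := 1 / (4 * s)) (by positivity)
  rw [finrank_euclideanSpace, Fintype.card_fin] at h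
  convert h using 2
  · ext x
    congr 1
    ring
  · field_simp

theorem integrableOn_fracHeatKernel (n : ℕ) {α : ℝ} (hα : 0 < α) (T : ℝ) :
    IntegrableOn (fracHeatKernel n α) (Set.univ ×ˢ Set.Ioo 0 T) := by
  rcases le_or_gt T 0 with hT | hT
  · simp [Set.Ioo_eq_empty (not_lt.2 hT)]
  have hΓ := Real.Gamma_pos_of_pos hα
  rw [IntegrableOn, Measure.volume_eq_prod, ← Measure.prod_restrict, Measure.restrict_univ,
    integrable_prod_iff' (measurable_fracHeatKernel n α).aestronglyMeasurable]
  have hslice : ∀ s ∈ Set.Ioo 0 T, (fun x : EuclideanSpace ℝ (Fin n) => fracHeatKernel n α (x, s))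
      = fun x => s ^ (α - 1) / Real.Gamma α * (1 / (4 * Real.pi * s) ^ ((n : ℝ) / 2)) *
          Real.exp (-‖x‖ ^ 2 / (4 * s)) := by
    intro s hs
    ext x
    simp [fracHeatKernel, hs.1]
  constructor
  · refine (ae_restrict_mem measurableSet_Ioo).mono fun s hs => ?_
    rw [hslice s hs]
    refine Integrable.const_mul ?_ _
    refine not_imp_comm.1 integral_undef ?_
    rw [integral_exp_neg_sq_div n hs.1]
    have := hs.1
    positivity
  · have hfib : ∀ s ∈ Set.Ioo 0 T,
        ∫ x : EuclideanSpace ℝ (Fin n), ‖fracHeatKernel n α (x, s)‖ =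
          s ^ (α - 1) / Real.Gamma α := by
      intro s hs
      have hs0 := hs.1
      simp_rw [Real.norm_of_nonneg (fracHeatKernel_nonneg n hα _)]
      rw [hslice s hs, integral_const_mul, integral_exp_neg_sq_div n hs0]
      have : (4 * Real.pi * s) ^ ((n : ℝ) / 2) ≠ 0 := by positivity
      field_simp
    change IntegrableOn _ _ _
    rw [integrableOn_congr_fun hfib measurableSet_Ioo]
    exact Integrable.div_const
      ((intervalIntegral.integrableOn_Ioo_rpow_iff hT).2 (by linarith)) _

/-- The potential of a function which vanishes for negative times and is integrable up to any
finite time converges absolutely almost everywhere. -/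
theorem ae_integrableOn_potentialIntegrand {n : ℕ} {α : ℝ} (hα : 0 < α) {F : SpaceTime n → ℝ}
    (hF : ∀ T : ℝ, IntegrableOn F (pastOf n T)) (hF0 : ∀ z : SpaceTime n, z.2 < 0 → F z = 0) :
    ∀ᵐ z : SpaceTime n, IntegrableOn (potentialIntegrand α F z) (pastOf n z.2) := by
  have key : ∀ T : ℕ, ∀ᵐ z : SpaceTime n, z.2 < T →
      IntegrableOn (potentialIntegrand α F z) (pastOf n z.2) := by
    intro T
    set K : SpaceTime n → ℝ := (Set.univ ×ˢ Set.Ioo 0 ((T : ℝ) + 1)).indicator (fracHeatKernel n α)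
    have hK : Integrable K := (integrable_indicator_iff
      (MeasurableSet.univ.prod measurableSet_Ioo)).2 (integrableOn_fracHeatKernel n hα _)
    have hG : Integrable ((pastOf n T).indicator F) :=
      (integrable_indicator_iff (measurableSet_pastOf n T)).2 (hF T)
    filter_upwards [hG.ae_convolution_exists (ContinuousLinearMap.mul ℝ ℝ) hK] with z hz hzT
    refine (hz.integrableOn (s := pastOf n z.2)).congr_fun (fun w hw => ?_)
      (measurableSet_pastOf n _)
    have hw' : w.2 < z.2 := hw
    have hwT : w ∈ pastOf n T := hw'.trans hzT
    simp only [ContinuousLinearMap.mul_apply', Set.indicator_of_mem hwT, potentialIntegrand]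
    rcases lt_or_ge w.2 0 with h | h
    · simp [hF0 w h]
    · have : z - w ∈ (Set.univ : Set (EuclideanSpace ℝ (Fin n))) ×ˢ Set.Ioo 0 ((T : ℝ) + 1) :=
        ⟨trivial, by simpa using hw', by simp only [Prod.snd_sub]; linarith⟩
      simp only [K, Set.indicator_of_mem this]
      ring
  filter_upwards [ae_all_iff.2 key] with z hz
  obtain ⟨T, hT⟩ := exists_nat_gt z.2
  exact hz T hT

theorem fracHeatPotential_nonneg {n : ℕ} {α : ℝ} (hα : 0 < α) {F : SpaceTime n → ℝ}
    (hF : ∀ z, 0 ≤ F z) (z : SpaceTime n) : 0 ≤ fracHeatPotential α F z :=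
  integral_nonneg fun w => mul_nonneg (fracHeatKernel_nonneg n hα _) (hF w)

theorem fracHeatPotential_eq_zero {n : ℕ} (α : ℝ) {F : SpaceTime n → ℝ}
    (hF : ∀ z : SpaceTime n, z.2 < 0 → F z = 0) {z : SpaceTime n} (hz : z.2 < 0) :
    fracHeatPotential α F z = 0 :=
  setIntegral_eq_zero_of_forall_eq_zero fun w hw => by
    simp [potentialIntegrand, hF w (lt_trans hw hz)]

theorem fracHeatKernel_ge {n : ℕ} {α : ℝ} (hα : 0 < α) {z : SpaceTime n} {s : ℝ} (hs : 0 < s)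
    (h1 : s / 2 < z.2) (h2 : z.2 < s) (hx : ‖z.1‖ ^ 2 ≤ 9 / 4 * s) :
    (1 / 2 : ℝ) ^ α / Real.Gamma α * (1 / (4 * Real.pi) ^ ((n : ℝ) / 2)) * Real.exp (-(9 / 8)) *
      s ^ (α - 1 - (n : ℝ) / 2) ≤ fracHeatKernel n α z := by
  have hΓ := Real.Gamma_pos_of_pos hα
  have hz : 0 < z.2 := (half_pos hs).trans h1
  have e1 : (1 / 2 : ℝ) ^ α * s ^ (α - 1) ≤ z.2 ^ (α - 1) := by
    have e : z.2 ^ (α - 1) = (z.2 / s) ^ (α - 1) * s ^ (α - 1) := by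
      rw [← Real.mul_rpow (by positivity) hs.le, div_mul_cancel₀ _ hs.ne']
    rw [e]
    gcongr
    calc (1 / 2 : ℝ) ^ α ≤ (z.2 / s) ^ α :=
          Real.rpow_le_rpow (by norm_num) (by rw [le_div_iff₀ hs]; linarith) hα.le
      _ ≤ (z.2 / s) ^ (α - 1) :=
          Real.rpow_le_rpow_of_exponent_ge (by positivity) ((div_le_one hs).2 h2.le) (by linarith)
  have e2 : 1 / (4 * Real.pi * s) ^ ((n : ℝ) / 2) ≤ 1 / (4 * Real.pi * z.2) ^ ((n : ℝ) / 2) := by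
    have := Real.pi_pos
    gcongr
  have e3 : Real.exp (-(9 / 8)) ≤ Real.exp (-‖z.1‖ ^ 2 / (4 * z.2)) := by
    refine Real.exp_le_exp.2 ?_
    rw [neg_div, neg_le_neg_iff, div_le_iff₀ (by positivity)]
    linarith
  rw [fracHeatKernel, if_pos hz]
  calc _ = (1 / 2 : ℝ) ^ α * s ^ (α - 1) / Real.Gamma α * (1 / (4 * Real.pi * s) ^ ((n : ℝ) / 2)) *
        Real.exp (-(9 / 8)) := by
        rw [Real.rpow_sub hs (α - 1), Real.mul_rpow (by positivity) hs.le]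
        have : s ^ ((n : ℝ) / 2) ≠ 0 := by positivity
        field_simp
    _ ≤ _ := by gcongr

/-- On the paraboloids the potential of order `α` raises the exponent of the power by `α`. -/
theorem exists_le_fracHeatPotential_paraboloidPower (n : ℕ) {α κ : ℝ} (hα : 0 < α) (hκ : 0 < κ)
    (hκn : κ < (n : ℝ) / 2 + 1) :
    ∃ c : ℝ, 0 < c ∧ ∀ M : ℝ, 0 < M → ∀ᵐ z : SpaceTime n, z ∈ paraboloids n →
      c * M * Int.fract z.2 ^ (α - κ) ≤
        fracHeatPotential α (fun w => M * paraboloidPower n κ w) z := by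
  have hΓ := Real.Gamma_pos_of_pos hα
  set ω := volume.real (Metric.ball (0 : EuclideanSpace ℝ (Fin n)) 1) with hω
  have hωpos : 0 < ω := volumeReal_unitBall_pos n
  set A := (1 / 2 : ℝ) ^ α / Real.Gamma α * (1 / (4 * Real.pi) ^ ((n : ℝ) / 2)) *
    Real.exp (-(9 / 8)) with hA
  have hApos : 0 < A := by positivity
  refine ⟨A * ((1 / 2) ^ n * ω * (1 / 4)), by positivity, fun M hM => ?_⟩
  have hneg : ∀ z : SpaceTime n, z.2 < 0 → M * paraboloidPower n κ z = 0 := fun z hz => by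
    rw [paraboloidPower_of_notMem κ fun h => by linarith [h.1], mul_zero]
  filter_upwards [ae_integrableOn_potentialIntegrand hα
    (fun T => (integrableOn_paraboloidPower_pastOf n hκn T).const_mul M) hneg] with z hz hzmem
  set s := Int.fract z.2 with hsdef
  have hs : 0 < s := fract_pos_of_mem_paraboloids hzmem
  have hs1 : s < 1 := Int.fract_lt_one _
  have hzs : z.2 = ⌊z.2⌋ + s := (Int.floor_add_fract _).symm
  set m : ℤ := ⌊z.2⌋ with hm
  have hm2 : (2 : ℝ) ≤ m := by exact_mod_cast Int.le_floor.2 (by exact_mod_cast hzmem.1)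
  set B : Set (SpaceTime n) := Metric.ball 0 (√s / 2) ×ˢ Set.Ioo (m + s / 4) (m + s / 2) with hB
  have hBmeas : MeasurableSet B := measurableSet_ball.prod measurableSet_Ioo
  have hsq : √s ^ 2 = s := Real.sq_sqrt hs.le
  have hsqpos : 0 < √s := Real.sqrt_pos.2 hs
  have hBpast : B ⊆ pastOf n z.2 := fun w hw => by
    have := hw.2.2
    change w.2 < z.2
    linarith
  have hBvol : volume.real B = √s ^ n * ((1 / 2) ^ n * ω) * (s / 4) := by
    rw [hB, Measure.volume_eq_prod, measureReal_prod_prod,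
      volumeReal_ball_euclidean n (half_pos hsqpos), Real.volume_real_Ioo_of_le (by linarith),
      div_pow, ← hω, one_div, inv_pow]
    ring
  have hBfin : volume B ≠ ∞ := by
    rw [hB, Measure.volume_eq_prod, Measure.prod_prod]
    exact (ENNReal.mul_lt_top measure_ball_lt_top (by simp)).ne
  have hlow : ∀ w ∈ B, A * s ^ (α - 1 - (n : ℝ) / 2) * (M * s ^ (-κ)) ≤
      potentialIntegrand α (fun w => M * paraboloidPower n κ w) z w := by
    intro w hw
    have hw1 : ‖w.1‖ < √s / 2 := by simpa using hw.1
    obtain ⟨hw2, hw3⟩ := hw.2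
    have hfr : Int.fract w.2 = w.2 - m := by
      rw [Int.fract, show ⌊w.2⌋ = m from Int.floor_eq_iff.2 ⟨by linarith, by linarith⟩]
    have hwmem : w ∈ paraboloids n := by
      refine ⟨by linarith, ?_⟩
      rw [hfr]
      nlinarith [norm_nonneg w.1]
    refine mul_le_mul ?_ ?_ (by positivity) (fracHeatKernel_nonneg n hα _)
    · refine fracHeatKernel_ge hα hs ?_ ?_ ?_
      · rw [Prod.snd_sub]; linarith
      · rw [Prod.snd_sub]; linarith
      · have h1 : ‖z.1‖ < √s := Real.lt_sqrt_of_sq_lt hzmem.2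
        have h2 : ‖z.1 - w.1‖ ≤ 3 / 2 * √s := (norm_sub_le _ _).trans (by linarith)
        rw [Prod.fst_sub]
        nlinarith [norm_nonneg (z.1 - w.1)]
    · beta_reduce
      rw [paraboloidPower_of_mem κ hwmem, hfr]
      gcongr M * ?_
      exact Real.rpow_le_rpow_of_nonpos (by linarith) (by linarith) (by linarith)
  calc A * ((1 / 2) ^ n * ω * (1 / 4)) * M * s ^ (α - κ)
      = A * s ^ (α - 1 - (n : ℝ) / 2) * (M * s ^ (-κ)) * volume.real B := by
        rw [hBvol, sqrt_pow_eq_rpow_half hs.le,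
          show α - κ = (α - 1 - (n : ℝ) / 2) + (-κ) + (n : ℝ) / 2 + 1 by ring,
          Real.rpow_add hs, Real.rpow_add hs, Real.rpow_add hs, Real.rpow_one]
        ring
    _ ≤ ∫ w in B, potentialIntegrand α (fun w => M * paraboloidPower n κ w) z w :=
        setIntegral_ge_of_const_le_real hBmeas hBfin hlow (hz.mono_set hBpast)
    _ ≤ _ := setIntegral_mono_set hz
        (Eventually.of_forall fun w => mul_nonneg (fracHeatKernel_nonneg n hα _)
          (mul_nonneg hM.le (paraboloidPower_nonneg n κ w))) hBpast.eventuallyLE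

theorem hasFracHeat_potential_paraboloidPower (n : ℕ) {p α κ : ℝ} (hp : 1 ≤ p) (hα : 0 < α)
    (hκ : 0 < κ) (hκp : κ * p < (n : ℝ) / 2 + 1) (M : ℝ) :
    HasFracHeat p α (fracHeatPotential α fun z => M * paraboloidPower n κ z)
      (fun z => M * paraboloidPower n κ z) where
  memX := memX_const_mul_paraboloidPower n hp hκp M
  convergent := ae_integrableOn_potentialIntegrand hα
    (fun T => (integrableOn_paraboloidPower_pastOf n (by nlinarith) T).const_mul M) fun z hz => by
      rw [paraboloidPower_of_notMem κ fun h => by linarith [h.1], mul_zero]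
  eq_potential := Eventually.of_forall fun _ => rfl

/-- If `U ≥ c M (t - m)^(α - κ)` on the paraboloids, then `U^σ` dominates a prescribed multiple of
the power with exponent `κ' = σ (κ - α)`. -/
theorem const_mul_paraboloidPower_le_rpow {n : ℕ} {α κ κ' σ c M M' : ℝ} (hσ : 0 < σ)
    (hc : 0 ≤ c * M) (hκ' : κ' = σ * (κ - α)) (hM' : M' ≤ (c * M) ^ σ) {U : SpaceTime n → ℝ}
    {z : SpaceTime n} (hU0 : 0 ≤ U z)
    (hU : z ∈ paraboloids n → c * M * Int.fract z.2 ^ (α - κ) ≤ U z) :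
    M' * paraboloidPower n κ' z ≤ U z ^ σ := by
  by_cases hz : z ∈ paraboloids n
  · have hs := fract_pos_of_mem_paraboloids hz
    calc M' * paraboloidPower n κ' z ≤ (c * M) ^ σ * Int.fract z.2 ^ (-κ') := by
          rw [paraboloidPower_of_mem κ' hz]
          gcongr
      _ = (c * M * Int.fract z.2 ^ (α - κ)) ^ σ := by
          rw [Real.mul_rpow hc (by positivity), ← Real.rpow_mul hs.le]
          congr 2
          rw [hκ']
          ring
      _ ≤ U z ^ σ := Real.rpow_le_rpow (by positivity) (hU hz) hσ.le
  · rw [paraboloidPower_of_notMem κ' hz, mul_zero]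
    exact Real.rpow_nonneg hU0 σ

theorem exists_pos_eq_rpow_mul_rpow {σ lam c₁ c₂ : ℝ} (h : 1 < lam * σ) (h₁ : 0 < c₁)
    (h₂ : 0 < c₂) : ∃ M : ℝ, 0 < M ∧ M = (c₁ * (c₂ * M) ^ lam) ^ σ := by
  have hne : 1 - lam * σ ≠ 0 := by linarith
  set C := c₁ ^ σ * c₂ ^ (lam * σ) with hC
  have hCpos : 0 < C := by positivity
  refine ⟨C ^ (1 / (1 - lam * σ)), by positivity, ?_⟩
  rw [Real.mul_rpow h₁.le (by positivity), ← Real.rpow_mul (by positivity),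
    Real.mul_rpow h₂.le (by positivity), ← mul_assoc, ← hC, ← Real.rpow_mul hCpos.le]
  nth_rewrite 2 [← Real.rpow_one C]
  rw [← Real.rpow_add hCpos]
  congr 1
  field_simp
  ring

section exponents

variable {n : ℕ} {p q lam σ α β : ℝ}

theorem mul_lt_of_muCurve_lt (hlam : 0 < lam) (hsub : 2 * p * α < (n : ℝ) + 2)
    (hμ : muCurve n p α β lam < σ) :
    2 * p * β * lam + ((n : ℝ) + 2) < ((n : ℝ) + 2 - 2 * p * α) * (lam * σ) := by
  have hA : 0 < (n : ℝ) + 2 - 2 * p * α := by linarith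
  have h : muCurve n p α β lam =
      (2 * p * β * lam + ((n : ℝ) + 2)) / (((n : ℝ) + 2 - 2 * p * α) * lam) := by
    rw [muCurve]
    field_simp
  rw [h, div_lt_iff₀ (by positivity)] at hμ
  linarith

theorem one_lt_mul_of_muCurve_lt (hp : 0 < p) (hlam : 0 < lam) (hα : 0 < α)
    (hβ : 0 < β) (hsub : 2 * p * α < (n : ℝ) + 2) (hμ : muCurve n p α β lam < σ) :
    1 < lam * σ := by
  have h := mul_lt_of_muCurve_lt hlam hsub hμ
  have hA : 0 < (n : ℝ) + 2 - 2 * p * α := by linarith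
  have h1 : 0 < 2 * p * β * lam := by positivity
  have h2 : 0 < 2 * p * α := by positivity
  by_contra! hle
  nlinarith

theorem lt_rZero (hlam : 0 < lam) (hσ : 0 < σ) (hα : 0 < α) (hβ : 0 < β)
    (hsub : 2 * p * α < (n : ℝ) + 2) (hμ : muCurve n p α β lam < σ) :
    p < rZero n lam σ α β := by
  have h := mul_lt_of_muCurve_lt hlam hsub hμ
  rw [rZero, lt_div_iff₀ (by positivity)]
  linarith

theorem lt_sZero (hp : 0 < p) (hq : 0 < q) (hlam : 0 < lam) (hσ : 0 < σ) (hα : 0 < α)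
    (hβ : 0 < β)
    (hsym : ((n : ℝ) + 2 - 2 * p * α) * q ^ 2 * σ ≤ ((n : ℝ) + 2 - 2 * q * β) * p ^ 2 * lam)
    (hsub : 2 * p * α < (n : ℝ) + 2) (hμ : muCurve n p α β lam < σ) :
    q < sZero n lam σ α β := by
  have h := mul_lt_of_muCurve_lt hlam hsub hμ
  have h1 := one_lt_mul_of_muCurve_lt hp hlam hα hβ hsub hμ
  rw [sZero, lt_div_iff₀ (by positivity)]
  set N := (n : ℝ) + 2
  set l := p / q * lam with hl
  set m := q / p * σ with hm
  have hlpos : 0 < l := by positivity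
  have hmpos : 0 < m := by positivity
  have hlm : l * m = lam * σ := by rw [hl, hm]; field_simp
  have hlam' : p * lam = q * l := by rw [hl]; field_simp
  have hσ' : q * σ = p * m := by rw [hm]; field_simp
  set P := (N - 2 * p * α) * m with hP
  set Q := (N - 2 * q * β) * l with hQ
  have hPQ : P ≤ Q := by
    have e1 : P * (p * q) = (N - 2 * p * α) * q ^ 2 * σ := by
      rw [hP]; linear_combination -(N - 2 * p * α) * q * hσ'
    have e2 : Q * (p * q) = (N - 2 * q * β) * p ^ 2 * lam := by
      rw [hQ]; linear_combination -(N - 2 * q * β) * p * hlam'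
    have : 0 < p * q := by positivity
    nlinarith
  have hstart : N * (l + 1) < P * l + Q := by
    have e : P * l + Q - N * (l + 1) =
        (N - 2 * p * α) * (lam * σ) - (2 * p * β * lam + N) := by
      rw [hP, hQ]; linear_combination (N - 2 * p * α) * hlm + 2 * β * hlam'
    linarith
  have hgoal : N * (m + 1) < Q * m + P := by
    rcases le_or_gt N P with hNP | hNP
    · nlinarith
    · have h2 : (N - P) * l < Q - N := by linarith
      have h3 : (N - P) * l * m < (Q - N) * m := mul_lt_mul_of_pos_right h2 hmpos
      rw [mul_assoc, hlm] at h3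
      nlinarith
  have e : Q * m + P - N * (m + 1) =
      N * (lam * σ - 1) - q * (2 * (α + β * lam) * σ) := by
    rw [hP, hQ]; linear_combination (N - 2 * q * β) * hlm + 2 * α * hσ'
  linarith

end exponents

theorem theorem2p6 (n : ℕ) (hn : 1 ≤ n) (p q lam σ α β : ℝ)
    (hp : 1 ≤ p) (hq : 1 ≤ q) (hlam : 0 < lam) (hσ : 0 < σ) (hα : 0 < α) (hβ : 0 < β)
    (hpα : AdmissibleExponents n p α) (hqβ : AdmissibleExponents n q β)
    (hsym : ((n : ℝ) + 2 - 2 * p * α) * q ^ 2 * σ ≤ ((n : ℝ) + 2 - 2 * q * β) * p ^ 2 * lam)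
    (hsub : 2 * p * α < (n : ℝ) + 2)
    (hμ : muCurve n p α β lam < σ) :
    p < rZero n lam σ α β ∧ q < sZero n lam σ α β ∧
    ∀ r s : ℝ≥0∞, ENNReal.ofReal (rZero n lam σ α β) ≤ r →
      ENNReal.ofReal (sZero n lam σ α β) ≤ s →
      ∃ (u v f g : SpaceTime n → ℝ) (t : ℕ → ℝ),
        IsSolutionPair p q lam σ α β u v f g ∧
        (∀ j, 1 < t j) ∧ Tendsto t atTop atTop ∧
        ∀ j,
          eLpNorm (fun z => v z ^ lam) r (volume.restrict (parabolicRegion n (t j))) = ∞ ∧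
          eLpNorm f r (volume.restrict (parabolicRegion n (t j))) = ∞ ∧
          eLpNorm (fun z => u z ^ σ) s (volume.restrict (parabolicRegion n (t j))) = ∞ ∧
          eLpNorm g s (volume.restrict (parabolicRegion n (t j))) = ∞ := by
  have hp0 : 0 < p := zero_lt_one.trans_le hp
  have hq0 : 0 < q := zero_lt_one.trans_le hq
  have hr := lt_rZero hlam hσ hα hβ hsub hμ
  have hs := lt_sZero hp0 hq0 hlam hσ hα hβ hsym hsub hμ
  have hls := one_lt_mul_of_muCurve_lt hp0 hlam hα hβ hsub hμ
  refine ⟨hr, hs, fun r s hrr hss => ?_⟩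
  have hd : 0 < lam * σ - 1 := by linarith
  have hd' : σ * lam - 1 ≠ 0 := by linarith
  obtain ⟨κ₁, hκ₁⟩ : ∃ κ, κ = lam * (β + α * σ) / (lam * σ - 1) := ⟨_, rfl⟩
  obtain ⟨κ₂, hκ₂⟩ : ∃ κ, κ = σ * (α + β * lam) / (lam * σ - 1) := ⟨_, rfl⟩
  have hκ₁pos : 0 < κ₁ := by rw [hκ₁]; positivity
  have hκ₂pos : 0 < κ₂ := by rw [hκ₂]; positivity
  have h12 : κ₁ = lam * (κ₂ - β) := by rw [hκ₁, hκ₂]; field_simp; ring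
  have h21 : κ₂ = σ * (κ₁ - α) := by rw [hκ₁, hκ₂]; field_simp; ring
  have hκr : κ₁ * rZero n lam σ α β = (n : ℝ) / 2 + 1 := by rw [hκ₁, rZero]; field_simp
  have hκs : κ₂ * sZero n lam σ α β = (n : ℝ) / 2 + 1 := by rw [hκ₂, sZero]; field_simp
  have hκp : κ₁ * p < (n : ℝ) / 2 + 1 := hκr ▸ mul_lt_mul_of_pos_left hr hκ₁pos
  have hκq : κ₂ * q < (n : ℝ) / 2 + 1 := hκs ▸ mul_lt_mul_of_pos_left hs hκ₂pos
  obtain ⟨c₁, hc₁, hlow₁⟩ :=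
    exists_le_fracHeatPotential_paraboloidPower n hα hκ₁pos (by nlinarith)
  obtain ⟨c₂, hc₂, hlow₂⟩ :=
    exists_le_fracHeatPotential_paraboloidPower n hβ hκ₂pos (by nlinarith)
  obtain ⟨M₂, hM₂, hM₂eq⟩ := exists_pos_eq_rpow_mul_rpow hls hc₁ hc₂
  obtain ⟨M₁, hM₁⟩ : ∃ M, M = (c₂ * M₂) ^ lam := ⟨_, rfl⟩
  have hM₁pos : 0 < M₁ := by rw [hM₁]; positivity
  rw [← hM₁] at hM₂eq
  set f : SpaceTime n → ℝ := fun z => M₁ * paraboloidPower n κ₁ z with hf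
  set g : SpaceTime n → ℝ := fun z => M₂ * paraboloidPower n κ₂ z with hg
  have hf0 : ∀ z, 0 ≤ f z := fun z => mul_nonneg hM₁pos.le (paraboloidPower_nonneg n κ₁ z)
  have hg0 : ∀ z, 0 ≤ g z := fun z => mul_nonneg hM₂.le (paraboloidPower_nonneg n κ₂ z)
  have hu0 := fracHeatPotential_nonneg hα hf0
  have hv0 := fracHeatPotential_nonneg hβ hg0
  have hnot : ∀ z : SpaceTime n, z.2 < 0 → z ∉ paraboloids n := fun z hz h => by
    linarith [h.1]
  have hfv : ∀ᵐ z, f z ≤ fracHeatPotential β g z ^ lam := (hlow₂ M₂ hM₂).mono fun z hz =>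
    const_mul_paraboloidPower_le_rpow hlam (by positivity) h12 hM₁.le (hv0 z) hz
  have hgu : ∀ᵐ z, g z ≤ fracHeatPotential α f z ^ σ := (hlow₁ M₁ hM₁pos).mono fun z hz =>
    const_mul_paraboloidPower_le_rpow hσ (by positivity) h21 hM₂eq.le (hu0 z) hz
  refine ⟨fracHeatPotential α f, fracHeatPotential β g, f, g, fun j => ((j + 2 : ℕ) : ℝ),
    ⟨hasFracHeat_potential_paraboloidPower n hp hα hκ₁pos hκp M₁,
      hasFracHeat_potential_paraboloidPower n hq hβ hκ₂pos hκq M₂,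
      Eventually.of_forall hu0, Eventually.of_forall hv0,
      hfv.mono fun z hz => ⟨hf0 z, hz⟩, hgu.mono fun z hz => ⟨hg0 z, hz⟩,
      Eventually.of_forall fun z hz => ⟨fracHeatPotential_eq_zero α (fun w hw => ?_) hz,
        fracHeatPotential_eq_zero β (fun w hw => ?_) hz⟩⟩,
    fun j => Nat.one_lt_cast.2 (by omega),
    tendsto_natCast_atTop_atTop.comp (tendsto_add_atTop_nat 2), fun j => ?_⟩
  · simp only [hf, paraboloidPower_of_notMem κ₁ (hnot w hw), mul_zero]
  · simp only [hg, paraboloidPower_of_notMem κ₂ (hnot w hw), mul_zero]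
  · have hftop := eLpNorm_paraboloidPower_parabolicRegion_eq_top n hM₁pos.ne' (hp0.trans hr) hκr hrr
      (show 2 ≤ j + 2 by omega)
    have hgtop := eLpNorm_paraboloidPower_parabolicRegion_eq_top n hM₂.ne' (hq0.trans hs) hκs hss
      (show 2 ≤ j + 2 by omega)
    refine ⟨?_, hftop, ?_, hgtop⟩
    · rw [eq_top_iff, ← hftop]
      refine eLpNorm_mono_ae (ae_restrict_of_ae (hfv.mono fun z hz => ?_))
      rwa [Real.norm_of_nonneg (hf0 z), Real.norm_of_nonneg (Real.rpow_nonneg (hv0 z) _)]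
    · rw [eq_top_iff, ← hgtop]
      refine eLpNorm_mono_ae (ae_restrict_of_ae (hgu.mono fun z hz => ?_))
      rwa [Real.norm_of_nonneg (hg0 z), Real.norm_of_nonneg (Real.rpow_nonneg (hu0 z) _)]
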